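/- **Theorem 3.19.** For a compact set $L\subset\mathbb C$ put $\Omega=\mathbb C\setminus L$. For $p\in\{0,1,2,\dots\}$ let $A^p(\Omega\cup\{\infty\})$ be the class of functions $f$ that are holomorphic in $\Omega$, continuous at $\infty$ with a finite value $f(\infty)=\lim_{z\to\infty}f(z)$, and such that every derivative $f^{(j)}$, $0\le j\le p$, extends continuously from $\Omega$ to the closure $\overline\Omega$ in $\mathbb C$. Define the $p$-continuous analytic capacity of $L$ by $$a_p(L)=\sup\Big\{\big|\lim_{z\to\infty}z\,(f(z)-f(\infty))\big| \;:\; f\in A^p(\Omega\cup\{\infty\}),\ \max_{0\le j\le p}\ \sup_{z\in\Omega}|f^{(j)}(z)|\le 1\Big\}.$$ 1. Let $K\subset[0,1]$ be the middle-thirds Cantor set and $L=K\times K=\{x+iy: x,y\in K\}$. Then $a_0(L)>0$, but $a_1(L)=0$. 2. More generally, let $L\subset\mathbb C$ be any compact set of zero area such that the set of $y\in\mathbb R$ for which the horizontal line $\{\operatorname{Im} z=y\}$ meets $L$ in a finite (possibly empty) set is dense in $\mathbb R$, and the set of $x\in\mathbb R$ for which the vertical line $\{\operatorname{Re} z=x\}$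 meets $L$ in a finite (possibly empty) set is dense in $\mathbb R$. Then $a_1(L)=0$. -/

import Mathlib

open Filter Topology MeasureTheory
open scoped ENNReal

/-- `MemA p L f c`: with `Ω = ℂ \ L` (`L` compact), the function `f` belongs to the class
`A^p(Ω ∪ {∞})` and `f(∞) = c`. That is, `f` is holomorphic in `Ω`, continuous at `∞` with
value `c`, and each derivative `f^(j)`, `0 ≤ j ≤ p`, has a continuous extension from `Ω` to the
closure of `Ω` in `ℂ`. The values of `f` on `L` play no role. -/
structure MemA (p : ℕ) (L : Set ℂ) (f : ℂ → ℂ) (c : ℂ) : Prop where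
  holomorphic : DifferentiableOn ℂ f Lᶜ
  tendsto_infty : Tendsto f (cocompact ℂ) (𝓝 c)
  extends_cont : ∀ j ≤ p, ∃ g : ℂ → ℂ,
    ContinuousOn g (closure Lᶜ) ∧ Set.EqOn g (iteratedDeriv j f) Lᶜ

/-- The `p`-continuous analytic capacity `a_p(L)` of a compact set `L ⊆ ℂ`, for finite `p`: the
supremum of `|lim_{z → ∞} z (f(z) - f(∞))|` over all `f ∈ A^p(Ω ∪ {∞})`, `Ω = ℂ \ L`, such that
`max_{0 ≤ j ≤ p} ‖f^(j)‖_∞ ≤ 1` (sup norms over `Ω`). The supremum is taken in `[0, ∞]`, so that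
it has no default value. -/
noncomputable def contAnalyticCapacity (p : ℕ) (L : Set ℂ) : ℝ≥0∞ :=
  sSup {r : ℝ≥0∞ | ∃ (f : ℂ → ℂ) (c l : ℂ), MemA p L f c ∧
    (∀ j ≤ p, ∀ z ∈ Lᶜ, ‖iteratedDeriv j f z‖ ≤ 1) ∧
    Tendsto (fun z : ℂ => z * (f z - c)) (cocompact ℂ) (𝓝 l) ∧ r = ‖l‖ₑ}

/-!
The vanishing of `a₁` is a removability statement. If `L` has zero area, its complement is dense, so
an admissible `f` and its derivative extend to continuous functions `F` and `G` on `ℂ`. On a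
horizontal or vertical line that meets `L` in a finite set, `F` is a primitive of `G` off finitely
many points, so the fundamental theorem of calculus holds along the line; by density and continuity
it holds along every horizontal and vertical segment (`sub_eq_intervalIntegral_of_dense_lines`).
Hence `F` has continuous partial derivatives `G` and `i G`, which makes it holomorphic
(`hasDerivAt_of_sub_eq_intervalIntegral`). By Liouville's theorem `F` is constant, and its
coefficient at infinity is zero (`contAnalyticCapacity_one_eq_zero`). The lines over the dense
complement of the Cantor set `K` miss `K × K`, so this applies to `K × K`.

The positivity of `a₀(K × K)` comes from the Cauchy transform of the product `ν` of two Cantor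
measures. Balls of radius `3⁻ⁿ` have `ν`-measure `O(4⁻ⁿ)` (`cantorDustMeasure_ball_le`). Truncating
the Cauchy kernel at radius `3⁻ⁿ` gives continuous functions whose successive differences are
`O((3/4)ⁿ)`, so they converge uniformly, and the limit is a bounded continuous extension of the
Cauchy transform (`exists_continuous_eq_cauchyTransform`). Its coefficient at infinity is the total
mass `1`.
-/

/-! ### Removability when the derivative extends continuously -/

/-- The fundamental theorem of calculus along all segments in the direction `v`. It is enough that
densely many lines in that direction meet the exceptional set `L` in a countable set: on those
lines the identity holds with countably many exceptions to differentiability, and both sides are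
continuous in the base point. -/
theorem sub_eq_intervalIntegral_of_dense_lines {F G : ℂ → ℂ} {L : Set ℂ} (hF : Continuous F)
    (hG : Continuous G) (hFG : ∀ z ∈ Lᶜ, HasDerivAt F (G z) z) {v : ℂ} (hv : v ≠ 0)
    (hL : Dense {z : ℂ | {w ∈ L | ∃ t : ℝ, w = z + t * v}.Countable}) (z : ℂ) (T : ℝ) :
    F (z + T * v) - F z = ∫ t in (0 : ℝ)..T, G (z + t * v) * v := by
  have hc : Continuous fun z : ℂ => ∫ t in (0 : ℝ)..T, G (z + t * v) * v := by
    apply intervalIntegral.continuous_parametric_intervalIntegral_of_continuous'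
    fun_prop
  refine congrFun (Continuous.ext_on hL (f := fun z => F (z + T * v) - F z) (by fun_prop) hc
    fun z hz => ?_) z
  have hinj : Function.Injective fun t : ℝ => z + t * v := fun s t h => by
    simpa [hv] using h
  have hcount : {t : ℝ | z + t * v ∈ L}.Countable := by
    refine (Set.Countable.preimage_of_injOn hz hinj.injOn).mono fun t ht => ?_
    exact ⟨ht, t, rfl⟩
  have := integral_eq_of_hasDerivAt_off_countable (fun t : ℝ => F (z + t * v))
    (fun t : ℝ => G (z + t * v) * v) (a := 0) (b := T) hcount
    (by fun_prop) (fun t ht => ?_)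
    (Continuous.intervalIntegrable (by fun_prop) _ _)
  · rw [this]
    simp
  · have h1 : HasDerivAt (fun t : ℝ => z + t * v) v t := by
      simpa using ((Complex.ofRealCLM.hasDerivAt (x := t)).mul_const v).const_add z
    exact (hFG _ ht.2).comp t h1

/-- If the increments of `F` along horizontal and vertical segments are the integrals of a
continuous function `G`, then `F` is holomorphic with derivative `G`. -/
theorem hasDerivAt_of_sub_eq_intervalIntegral {F G : ℂ → ℂ} (hG : Continuous G)
    (hre : ∀ (z : ℂ) (T : ℝ), F (z + T * 1) - F z = ∫ t in (0 : ℝ)..T, G (z + t * 1) * 1)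
    (him : ∀ (z : ℂ) (T : ℝ),
      F (z + T * Complex.I) - F z = ∫ t in (0 : ℝ)..T, G (z + t * Complex.I) * Complex.I)
    (z : ℂ) : HasDerivAt F (G z) z := by
  rw [hasDerivAt_iff_isLittleO_nhds_zero, Asymptotics.isLittleO_iff]
  intro ε hε
  obtain ⟨δ, hδ, hball⟩ := Metric.continuousAt_iff.1 (hG.continuousAt (x := z)) (ε / 2)
    (half_pos hε)
  filter_upwards [Metric.ball_mem_nhds (0 : ℂ) (half_pos hδ)] with h hh
  have hh : ‖h‖ < δ / 2 := by simpa using hh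
  have hsmall : ∀ w : ℂ, ‖w‖ < δ → ‖G (z + w) - G z‖ ≤ ε / 2 := fun w hw => by
    have := @hball (z + w) (by simpa [dist_eq_norm] using hw)
    rw [dist_eq_norm] at this
    exact this.le
  have hsub : ∀ {s T : ℝ}, s ∈ Set.uIoc 0 T → |s| ≤ |T| := fun {s T} hs => by
    have := Set.abs_sub_left_of_mem_uIcc (Set.uIoc_subset_uIcc hs)
    simpa using this
  have hb1 : ‖∫ t in (0 : ℝ)..h.re, (G (z + t * 1) * 1 - G z)‖ ≤ ε / 2 * |h.re - 0| := by
    refine intervalIntegral.norm_integral_le_of_norm_le_const fun t ht => ?_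
    have h1 := hsmall (t * 1) (by
      rw [mul_one, Complex.norm_real, Real.norm_eq_abs]
      linarith [hsub ht, Complex.abs_re_le_norm h])
    simpa using h1
  have hb2 : ‖∫ t in (0 : ℝ)..h.im,
      (G (z + h.re * 1 + t * Complex.I) * Complex.I - G z * Complex.I)‖ ≤ ε / 2 * |h.im - 0| := by
    refine intervalIntegral.norm_integral_le_of_norm_le_const fun t ht => ?_
    rw [← sub_mul, norm_mul, Complex.norm_I, mul_one, add_assoc]
    refine hsmall _ ((norm_add_le _ _).trans_lt ?_)
    simp only [mul_one, norm_mul, Complex.norm_I, Complex.norm_real, Real.norm_eq_abs]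
    linarith [hsub ht, Complex.abs_re_le_norm h, Complex.abs_im_le_norm h]
  have key : F (z + h) - F z - h • G z =
      (∫ t in (0 : ℝ)..h.re, (G (z + t * 1) * 1 - G z)) +
      ∫ t in (0 : ℝ)..h.im,
        (G (z + h.re * 1 + t * Complex.I) * Complex.I - G z * Complex.I) := by
    rw [intervalIntegral.integral_sub (Continuous.intervalIntegrable (by fun_prop) _ _)
        (Continuous.intervalIntegrable (by fun_prop) _ _),
      intervalIntegral.integral_sub (Continuous.intervalIntegrable (by fun_prop) _ _)
        (Continuous.intervalIntegrable (by fun_prop) _ _), ← hre, ← him]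
    have e : z + h.re * 1 + h.im * Complex.I = z + h := by
      rw [mul_one, add_assoc, Complex.re_add_im]
    rw [e]
    simp only [intervalIntegral.integral_const, sub_zero, Complex.real_smul, smul_eq_mul]
    nth_rewrite 2 [← Complex.re_add_im h]
    ring
  rw [key]
  refine (norm_add_le _ _).trans ?_
  rw [sub_zero] at hb1 hb2
  nlinarith [Complex.abs_re_le_norm h, Complex.abs_im_le_norm h]

/-- Every admissible function extends to an entire function with a finite limit at infinity, hence
is constant. Zero area only serves to make the complement of `L` dense, so that the extensions of
`f` and `f'` are continuous on all of `ℂ`. -/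
theorem contAnalyticCapacity_one_eq_zero {L : Set ℂ} (hL : IsCompact L) (h0 : volume L = 0)
    (hy : Dense {y : ℝ | {z : ℂ | z ∈ L ∧ z.im = y}.Finite})
    (hx : Dense {x : ℝ | {z : ℂ | z ∈ L ∧ z.re = x}.Finite}) :
    contAnalyticCapacity 1 L = 0 := by
  have hdense : Dense Lᶜ := by
    rw [← interior_eq_empty_iff_dense_compl]
    exact Measure.interior_eq_empty_of_null h0
  refine le_antisymm (sSup_le ?_) zero_le
  rintro r ⟨f, c, l, hf, -, hl, rfl⟩
  obtain ⟨F, hFc, hFf⟩ := hf.extends_cont 0 zero_le_one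
  obtain ⟨G, hGc, hGf⟩ := hf.extends_cont 1 le_rfl
  rw [hdense.closure_eq, continuousOn_univ] at hFc hGc
  rw [iteratedDeriv_zero] at hFf
  rw [iteratedDeriv_one] at hGf
  have hopen : IsOpen Lᶜ := hL.isClosed.isOpen_compl
  have hFG : ∀ z ∈ Lᶜ, HasDerivAt F (G z) z := fun z hz => by
    rw [hGf hz]
    exact (hf.holomorphic.differentiableAt (hopen.mem_nhds hz)).hasDerivAt.congr_of_eventuallyEq
      (hFf.eventuallyEq_of_mem (hopen.mem_nhds hz))
  have hre := sub_eq_intervalIntegral_of_dense_lines hFc hGc hFG one_ne_zero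
    ((hy.preimage Complex.isOpenMap_im).mono fun z hz => (hz.subset (by
      rintro w ⟨hw, t, rfl⟩
      exact ⟨hw, by simp⟩)).countable)
  have him := sub_eq_intervalIntegral_of_dense_lines hFc hGc hFG Complex.I_ne_zero
    ((hx.preimage Complex.isOpenMap_re).mono fun z hz => (hz.subset (by
      rintro w ⟨hw, t, rfl⟩
      exact ⟨hw, by simp⟩)).countable)
  have hF : Differentiable ℂ F := fun z =>
    (hasDerivAt_of_sub_eq_intervalIntegral hGc hre him z).differentiableAt
  have hev : F =ᶠ[cocompact ℂ] f := hFf.eventuallyEq_of_mem hL.compl_mem_cocompact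
  have hconst : ∀ z, F z = c := fun z =>
    hF.apply_eq_of_tendsto_cocompact z (hf.tendsto_infty.congr' hev.symm)
  have hl0 : Tendsto (fun z : ℂ => z * (f z - c)) (cocompact ℂ) (𝓝 0) :=
    tendsto_const_nhds.congr' <| hev.mono fun z hz => by
      simp only [← hz, hconst, sub_self, mul_zero]
  rw [tendsto_nhds_unique hl hl0, enorm_zero]

/-! ### Cauchy transforms of measures with superlinear growth -/

/-- The Cauchy kernel `w⁻¹` made continuous: it agrees with `w⁻¹` for `r ≤ ‖w‖` and equals
`conj w / r ^ 2` for `‖w‖ ≤ r`. -/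
noncomputable def truncCauchyKernel (r : ℝ) (w : ℂ) : ℂ :=
  starRingEnd ℂ w / ((max ‖w‖ r : ℝ) : ℂ) ^ 2

theorem continuous_truncCauchyKernel {r : ℝ} (hr : 0 < r) : Continuous (truncCauchyKernel r) := by
  unfold truncCauchyKernel
  refine Continuous.div (by fun_prop) (by fun_prop) fun w => ?_
  have : 0 < max ‖w‖ r := lt_max_of_lt_right hr
  exact_mod_cast (pow_pos this 2).ne'

theorem norm_truncCauchyKernel_le {r : ℝ} (hr : 0 < r) (w : ℂ) :
    ‖truncCauchyKernel r w‖ ≤ r⁻¹ := by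
  have h : 0 < max ‖w‖ r := lt_max_of_lt_right hr
  rw [truncCauchyKernel, norm_div, RCLike.norm_conj, norm_pow, Complex.norm_real,
    Real.norm_of_nonneg h.le, div_le_iff₀ (by positivity), inv_mul_eq_div, le_div_iff₀ hr, sq]
  exact mul_le_mul (le_max_left _ _) (le_max_right _ _) hr.le h.le

theorem truncCauchyKernel_of_le {r : ℝ} {w : ℂ} (hw : r ≤ ‖w‖) :
    truncCauchyKernel r w = w⁻¹ := by
  rw [truncCauchyKernel, max_eq_left hw, Complex.inv_def, Complex.normSq_eq_norm_sq]
  push_cast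
  rfl

theorem norm_truncCauchyKernel_sub_le {r s : ℝ} (hs : 0 < s) (hsr : s ≤ r) (w : ℂ) :
    ‖truncCauchyKernel s w - truncCauchyKernel r w‖ ≤
      (Metric.ball 0 r).indicator (fun _ => 2 / s) w := by
  have hr := hs.trans_le hsr
  by_cases hw : w ∈ Metric.ball (0 : ℂ) r
  · rw [Set.indicator_of_mem hw]
    refine (norm_sub_le _ _).trans ?_
    have h1 := norm_truncCauchyKernel_le hs w
    have h2 := (norm_truncCauchyKernel_le hr w).trans (inv_anti₀ hs hsr)
    rw [div_eq_mul_inv]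
    linarith
  · rw [Set.indicator_of_notMem hw]
    have hw : r ≤ ‖w‖ := by simpa using hw
    rw [truncCauchyKernel_of_le (hsr.trans hw), truncCauchyKernel_of_le hw, sub_self,
      norm_zero]

theorem integrable_truncCauchyKernel (ν : Measure ℂ) [IsFiniteMeasure ν] {r : ℝ} (hr : 0 < r)
    (z : ℂ) : Integrable (fun w => truncCauchyKernel r (z - w)) ν :=
  Integrable.of_bound
    ((continuous_truncCauchyKernel hr).comp (by fun_prop)).aestronglyMeasurable r⁻¹
    (Eventually.of_forall fun _ => norm_truncCauchyKernel_le hr _)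

theorem continuous_integral_truncCauchyKernel (ν : Measure ℂ) [IsFiniteMeasure ν] {r : ℝ}
    (hr : 0 < r) : Continuous fun z => ∫ w, truncCauchyKernel r (z - w) ∂ν :=
  continuous_of_dominated (bound := fun _ => r⁻¹)
    (fun z => (integrable_truncCauchyKernel ν hr z).aestronglyMeasurable)
    (fun _ => Eventually.of_forall fun _ => norm_truncCauchyKernel_le hr _)
    (integrable_const _)
    (Eventually.of_forall fun w => (continuous_truncCauchyKernel hr).comp (by fun_prop))

/-- If the `ν`-measure of balls of radius `ρ ^ n` is `O(b ^ n)` with `b < ρ`, that is, if `ν` has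
growth of order larger than `1`, then the Cauchy transform of `ν` extends from the complement of a
closed set carrying `ν` to a bounded continuous function on `ℂ`. -/
theorem exists_continuous_eq_cauchyTransform (ν : Measure ℂ) [IsFiniteMeasure ν] {C ρ b : ℝ}
    (hρ : 0 < ρ) (hρ1 : ρ < 1) (hb : 0 ≤ b) (hbρ : b < ρ)
    (hν : ∀ (n : ℕ) (z : ℂ), ν.real (Metric.ball z (ρ ^ n)) ≤ C * b ^ n) {L : Set ℂ}
    (hL : IsClosed L) (hνL : ∀ᵐ w ∂ν, w ∈ L) :
    ∃ F : ℂ → ℂ, Continuous F ∧ (∃ M, ∀ z, ‖F z‖ ≤ M) ∧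
      ∀ z ∈ Lᶜ, F z = ∫ w, (z - w)⁻¹ ∂ν := by
  let D : ℕ → ℂ → ℂ := fun n z => ∫ w, truncCauchyKernel (ρ ^ n) (z - w) ∂ν
  have hDc : ∀ n, Continuous (D n) := fun n =>
    continuous_integral_truncCauchyKernel ν (pow_pos hρ n)
  have hDd : ∀ n z, ‖D (n + 1) z - D n z‖ ≤ 2 * C / ρ * (b / ρ) ^ n := fun n z => by
    have hp : 0 < ρ ^ n := pow_pos hρ n
    have hp' : 0 < ρ ^ (n + 1) := pow_pos hρ (n + 1)
    have hle : ρ ^ (n + 1) ≤ ρ ^ n := pow_le_pow_of_le_one hρ.le hρ1.le n.le_succ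
    rw [← integral_sub (integrable_truncCauchyKernel ν hp' z)
      (integrable_truncCauchyKernel ν hp z)]
    calc _ ≤ ∫ w, (Metric.ball z (ρ ^ n)).indicator (fun _ => 2 / ρ ^ (n + 1)) w ∂ν := by
          refine norm_integral_le_of_norm_le
            ((integrable_const _).indicator measurableSet_ball) (Eventually.of_forall fun w => ?_)
          have := norm_truncCauchyKernel_sub_le hp' hle (z - w)
          classical
          simpa only [Set.indicator_apply, Metric.mem_ball, dist_eq_norm, sub_zero,
            norm_sub_rev z w] using this
      _ = ν.real (Metric.ball z (ρ ^ n)) * (2 / ρ ^ (n + 1)) := by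
          rw [integral_indicator_const _ measurableSet_ball, smul_eq_mul]
      _ ≤ C * b ^ n * (2 / ρ ^ (n + 1)) := by gcongr; exact hν n z
      _ = _ := by rw [div_pow, pow_succ]; field_simp
  have hsum : Summable fun n : ℕ => 2 * C / ρ * (b / ρ) ^ n :=
    (summable_geometric_of_lt_one (by positivity) ((div_lt_one hρ).2 hbρ)).mul_left _
  refine ⟨fun z => D 0 z + ∑' n, (D (n + 1) z - D n z), (hDc 0).add
    (continuous_tsum (fun n => (hDc (n + 1)).sub (hDc n)) hsum hDd),
    ⟨ν.real Set.univ + ∑' n : ℕ, 2 * C / ρ * (b / ρ) ^ n, fun z => ?_⟩, fun z hz => ?_⟩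
  · refine (norm_add_le _ _).trans (add_le_add ?_ (tsum_of_norm_bounded hsum.hasSum (hDd · z)))
    have := norm_integral_le_of_norm_le_const (μ := ν) (C := 1)
      (f := fun w => truncCauchyKernel (ρ ^ 0) (z - w))
      (Eventually.of_forall fun w => by
        simpa using norm_truncCauchyKernel_le (pow_pos hρ 0) (z - w))
    simpa [D] using this
  · -- The kernels of radius less than `dist z L` agree with `w⁻¹` on `z - L`, so off `L` the telescoping
    -- partial sums are eventually equal to the Cauchy transform.
    obtain ⟨ε, hε, hball⟩ := Metric.isOpen_iff.1 hL.isOpen_compl z hz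
    have h1 : Tendsto (fun n => D n z) atTop (𝓝 (∫ w, (z - w)⁻¹ ∂ν)) := by
      refine tendsto_const_nhds.congr' ?_
      filter_upwards [(tendsto_pow_atTop_nhds_zero_of_lt_one hρ.le hρ1).eventually_lt_const hε]
        with n hn
      refine integral_congr_ae (hνL.mono fun w hw => ?_)
      refine (truncCauchyKernel_of_le (hn.le.trans ?_)).symm
      by_contra! hlt
      exact hball (a := w) (by rwa [Metric.mem_ball, dist_eq_norm, norm_sub_rev]) hw
    have h2 : Tendsto (fun n => D 0 z + ∑ i ∈ Finset.range n, (D (i + 1) z - D i z)) atTop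
        (𝓝 (D 0 z + ∑' n, (D (n + 1) z - D n z))) :=
      (Summable.of_norm_bounded hsum (hDd · z)).hasSum.tendsto_sum_nat.const_add _
    simp only [Finset.sum_range_sub (D · z), add_sub_cancel] at h2
    exact tendsto_nhds_unique h2 h1

theorem differentiableOn_cauchyTransform (ν : Measure ℂ) [IsFiniteMeasure ν] {L : Set ℂ}
    (hL : IsClosed L) (hνL : ∀ᵐ w ∂ν, w ∈ L) :
    DifferentiableOn ℂ (fun z => ∫ w, (z - w)⁻¹ ∂ν) Lᶜ := by
  intro z hz
  obtain ⟨ε, hε, hball⟩ := Metric.isOpen_iff.1 hL.isOpen_compl z hz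
  have hdist : ∀ x ∈ Metric.ball z (ε / 2), ∀ w ∈ L, ε / 2 ≤ ‖x - w‖ := fun x hx w hw => by
    by_contra! hlt
    refine hball (a := w) ?_ hw
    rw [Metric.mem_ball, dist_comm, dist_eq_norm]
    rw [Metric.mem_ball, dist_comm, dist_eq_norm] at hx
    calc ‖z - w‖ ≤ ‖z - x‖ + ‖x - w‖ := norm_sub_le_norm_sub_add_norm_sub _ _ _
      _ < ε := by linarith
  have hmeas : ∀ x : ℂ, AEStronglyMeasurable (fun w => (x - w)⁻¹) ν := fun x =>
    Measurable.aestronglyMeasurable (by fun_prop)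
  refine (hasDerivAt_integral_of_dominated_loc_of_deriv_le (F := fun z w => (z - w)⁻¹)
    (F' := fun z w => -1 / (z - w) ^ 2) (bound := fun _ => ((ε / 2) ^ 2)⁻¹)
    (Metric.ball_mem_nhds z (half_pos hε)) (Eventually.of_forall hmeas)
    (Integrable.of_bound (hmeas z) (ε / 2)⁻¹ ?_)
    (Measurable.aestronglyMeasurable (by fun_prop)) ?_ (integrable_const _)
    ?_).2.differentiableAt.differentiableWithinAt
  · filter_upwards [hνL] with w hw
    rw [norm_inv]
    exact inv_anti₀ (half_pos hε) (hdist z (Metric.mem_ball_self (half_pos hε)) w hw)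
  · filter_upwards [hνL] with w hw x hx
    rw [norm_div, norm_neg, norm_one, norm_pow, one_div]
    exact inv_anti₀ (by positivity) (pow_le_pow_left₀ (by positivity) (hdist x hx w hw) 2)
  · filter_upwards [hνL] with w hw x hx
    have hne : x - w ≠ 0 := norm_pos_iff.1 ((half_pos hε).trans_le (hdist x hx w hw))
    exact ((hasDerivAt_id x).sub_const w).fun_inv hne

theorem tendsto_mul_cauchyTransform (ν : Measure ℂ) [IsProbabilityMeasure ν] {L : Set ℂ}
    (hL : Bornology.IsBounded L) (hνL : ∀ᵐ w ∂ν, w ∈ L) :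
    Tendsto (fun z => z * ∫ w, (z - w)⁻¹ ∂ν) (cocompact ℂ) (𝓝 1) := by
  obtain ⟨R, hR, hLR⟩ := hL.exists_pos_norm_le
  have hnorm := tendsto_norm_cocompact_atTop (E := ℂ)
  rw [tendsto_iff_norm_sub_tendsto_zero]
  have h0 : Tendsto (fun z : ℂ => R / (‖z‖ - R)) (cocompact ℂ) (𝓝 0) :=
    (tendsto_atTop_add_const_right _ (-R) hnorm).const_div_atTop R
  refine squeeze_zero' (Eventually.of_forall fun _ => norm_nonneg _) ?_ h0
  filter_upwards [hnorm.eventually_gt_atTop R] with z hz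
  have hdist : ∀ w ∈ L, ‖z‖ - R ≤ ‖z - w‖ := fun w hw => by
    linarith [norm_sub_norm_le z w, hLR w hw]
  have hpos : 0 < ‖z‖ - R := by linarith
  have hint : Integrable (fun w => (z - w)⁻¹) ν := by
    refine Integrable.of_bound (Measurable.aestronglyMeasurable (by fun_prop)) (‖z‖ - R)⁻¹ ?_
    filter_upwards [hνL] with w hw
    rw [norm_inv]
    exact inv_anti₀ hpos (hdist w hw)
  have e : z * (∫ w, (z - w)⁻¹ ∂ν) - 1 = ∫ w, (z * (z - w)⁻¹ - 1) ∂ν := by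
    rw [integral_sub (hint.const_mul z) (integrable_const _), integral_const_mul]
    simp
  rw [e]
  refine (norm_integral_le_of_norm_le_const (C := R / (‖z‖ - R)) ?_).trans_eq (by simp)
  filter_upwards [hνL] with w hw
  have hne : z - w ≠ 0 := norm_pos_iff.1 (hpos.trans_le (hdist w hw))
  have e2 : z * (z - w)⁻¹ - 1 = w / (z - w) := by
    field_simp
    ring
  rw [e2, norm_div]
  exact div_le_div₀ hR.le (hLR w hw) hpos (hdist w hw)

/-- A compact set that carries a probability measure with growth of order larger than `1` has
positive continuous analytic capacity: normalize the Cauchy transform of the measure. -/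
theorem contAnalyticCapacity_zero_pos (ν : Measure ℂ) [IsProbabilityMeasure ν] {C ρ b : ℝ}
    (hρ : 0 < ρ) (hρ1 : ρ < 1) (hb : 0 ≤ b) (hbρ : b < ρ)
    (hν : ∀ (n : ℕ) (z : ℂ), ν.real (Metric.ball z (ρ ^ n)) ≤ C * b ^ n) {L : Set ℂ}
    (hL : IsCompact L) (hνL : ∀ᵐ w ∂ν, w ∈ L) : 0 < contAnalyticCapacity 0 L := by
  obtain ⟨F, hFc, ⟨M₀, hM₀⟩, hF⟩ :=
    exists_continuous_eq_cauchyTransform ν hρ hρ1 hb hbρ hν hL.isClosed hνL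
  obtain ⟨M, hMpos, hM⟩ : ∃ M : ℝ, 0 < M ∧ ∀ z, ‖F z‖ ≤ M :=
    ⟨max M₀ 1, lt_max_of_lt_right one_pos, fun z => (hM₀ z).trans (le_max_left _ _)⟩
  have hMne : (M : ℂ) ≠ 0 := by exact_mod_cast hMpos.ne'
  have hlim : Tendsto (fun z => z * F z) (cocompact ℂ) (𝓝 1) :=
    (tendsto_mul_cauchyTransform ν hL.isBounded hνL).congr' <| by
      filter_upwards [hL.compl_mem_cocompact] with z hz
      rw [hF z hz]
  have hlim0 : Tendsto F (cocompact ℂ) (𝓝 0) := by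
    have h := hlim.mul (Metric.cobounded_eq_cocompact (α := ℂ) ▸ tendsto_inv₀_cobounded)
    rw [mul_zero] at h
    refine h.congr' ?_
    filter_upwards [(isCompact_singleton (x := (0 : ℂ))).compl_mem_cocompact] with z hz
    have hz : z ≠ 0 := hz
    field_simp
  have hmem : (‖(M : ℂ)⁻¹‖ₑ : ℝ≥0∞) ≤ contAnalyticCapacity 0 L := by
    refine le_sSup ⟨fun z => F z * (M : ℂ)⁻¹, 0, (M : ℂ)⁻¹, ⟨?_, ?_, ?_⟩, ?_, ?_, rfl⟩
    · exact ((differentiableOn_cauchyTransform ν hL.isClosed hνL).congr hF).mul_const _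
    · simpa using hlim0.mul_const (M : ℂ)⁻¹
    · intro j hj
      obtain rfl : j = 0 := Nat.le_zero.1 hj
      exact ⟨fun z => F z * (M : ℂ)⁻¹, by fun_prop, fun z _ => by rw [iteratedDeriv_zero]⟩
    · intro j hj z _
      obtain rfl : j = 0 := Nat.le_zero.1 hj
      rw [iteratedDeriv_zero, norm_mul, norm_inv, Complex.norm_real,
        Real.norm_of_nonneg hMpos.le, ← div_eq_mul_inv]
      exact (div_le_one hMpos).2 (hM z)
    · simpa [mul_assoc] using hlim.mul_const (M : ℂ)⁻¹
  exact lt_of_lt_of_le (by simpa using hMne) hmem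

/-! ### The Cantor measure -/

/-- If two Cantor set points with digits `0` and `2` are closer than `3⁻¹ ^ n`, then their first
`n` ternary digits agree: the gap opened at level `k` has length `3⁻¹ ^ (k + 1)`. -/
theorem digits_eq_of_abs_ofDigits_sub_lt {x y : ℕ → Bool} {n : ℕ}
    (h : |Real.ofDigits (fun i => cond (x i) (2 : Fin 3) 0) -
      Real.ofDigits (fun i => cond (y i) (2 : Fin 3) 0)| < (3⁻¹ : ℝ) ^ n) :
    ∀ i < n, x i = y i := by
  intro i
  induction i using Nat.strong_induction_on with
  | _ i ih =>
    intro hi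
    by_contra hne
    wlog hxy : x i = true ∧ y i = false generalizing x y
    · refine this (by rwa [abs_sub_comm]) (fun j hj hjn => (ih j hj hjn).symm) (Ne.symm hne) ?_
      cases hx : x i <;> cases hy : y i <;> simp_all
    have hsum : ∑ j ∈ Finset.range i, Real.ofDigitsTerm (fun i => cond (x i) (2 : Fin 3) 0) j =
        ∑ j ∈ Finset.range i, Real.ofDigitsTerm (fun i => cond (y i) (2 : Fin 3) 0) j :=
      Finset.sum_congr rfl fun j hj => by
        rw [Finset.mem_range] at hj
        simp only [Real.ofDigitsTerm, ih j hj (hj.trans hi)]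
    rw [Real.ofDigits_eq_sum_add_ofDigits _ (i + 1),
      Real.ofDigits_eq_sum_add_ofDigits (fun j => cond (y j) (2 : Fin 3) 0) (i + 1),
      Finset.sum_range_succ, Finset.sum_range_succ, hsum] at h
    have h0 := Real.ofDigits_nonneg fun j => cond (x (j + (i + 1))) (2 : Fin 3) 0
    have h1 := Real.ofDigits_le_one fun j => cond (y (j + (i + 1))) (2 : Fin 3) 0
    have hpow : (3⁻¹ : ℝ) ^ n ≤ ((3 : ℝ) ^ (i + 1))⁻¹ := by
      rw [← inv_pow]
      exact pow_le_pow_of_le_one (by norm_num) (by norm_num) hi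
    have hp : 0 ≤ ((3 : ℝ) ^ (i + 1))⁻¹ := by positivity
    have htx : Real.ofDigitsTerm (fun i => cond (x i) (2 : Fin 3) 0) i =
        2 * ((3 : ℝ) ^ (i + 1))⁻¹ := by simp [Real.ofDigitsTerm, hxy.1]
    have hty : Real.ofDigitsTerm (fun i => cond (y i) (2 : Fin 3) 0) i = 0 := by
      simp [Real.ofDigitsTerm, hxy.2]
    rw [htx, hty, Nat.cast_ofNat] at h
    linarith [(abs_lt.1 h).2, mul_nonneg hp h0, mul_le_of_le_one_right hp h1]

/-- The Cantor measure: the law of `∑ 2 * εᵢ / 3 ^ (i + 1)` for independent fair bits `εᵢ`. -/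
noncomputable def cantorMeasure : Measure ℝ :=
  (Measure.infinitePi fun _ : ℕ => (PMF.uniformOfFintype Bool).toMeasure).map
    fun x => Real.ofDigits fun i => cond (x i) (2 : Fin 3) 0

theorem measurable_ofDigits_cond :
    Measurable fun x : ℕ → Bool => Real.ofDigits fun i => cond (x i) (2 : Fin 3) 0 :=
  (Real.continuous_ofDigits.comp (by fun_prop)).measurable

instance isProbabilityMeasure_cantorMeasure : IsProbabilityMeasure cantorMeasure :=
  Measure.isProbabilityMeasure_map measurable_ofDigits_cond.aemeasurable

theorem ae_mem_cantorSet : ∀ᵐ x ∂cantorMeasure, x ∈ cantorSet := by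
  refine (ae_map_iff measurable_ofDigits_cond.aemeasurable
    isClosed_cantorSet.measurableSet).2 (Eventually.of_forall fun x => ?_)
  exact ofDigits_bool_to_fin_three_mem_cantorSet x

/-- The Cantor measure has growth of order `log 2 / log 3`: a ball of radius `3⁻¹ ^ (n + 1)` meets
only points that share their first `n` digits. -/
theorem cantorMeasure_ball_le (n : ℕ) (c : ℝ) :
    cantorMeasure (Metric.ball c (3⁻¹ ^ (n + 1))) ≤ 2⁻¹ ^ n := by
  rw [cantorMeasure, Measure.map_apply measurable_ofDigits_cond measurableSet_ball]
  rcases Set.eq_empty_or_nonempty ((fun x : ℕ → Bool => Real.ofDigits fun i =>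
    cond (x i) (2 : Fin 3) 0) ⁻¹' Metric.ball c (3⁻¹ ^ (n + 1))) with he | ⟨y, hy⟩
  · rw [he, measure_empty]
    exact zero_le
  have hsub : (fun x : ℕ → Bool => Real.ofDigits fun i =>
      cond (x i) (2 : Fin 3) 0) ⁻¹' Metric.ball c (3⁻¹ ^ (n + 1)) ⊆
      Set.pi (Finset.range n) fun i => {y i} := fun x hx i hi => by
    refine digits_eq_of_abs_ofDigits_sub_lt (n := n) ?_ i (by simpa using hi)
    rw [Set.mem_preimage, Metric.mem_ball] at hx hy
    have := dist_triangle_right (Real.ofDigits fun i => cond (x i) (2 : Fin 3) 0)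
      (Real.ofDigits fun i => cond (y i) (2 : Fin 3) 0) c
    rw [Real.dist_eq] at this
    have hp : (0 : ℝ) < 3⁻¹ ^ n := by positivity
    rw [pow_succ] at hx hy
    linarith
  refine (measure_mono hsub).trans ?_
  rw [Measure.infinitePi_pi _ fun _ _ => MeasurableSet.singleton _]
  simp [PMF.uniformOfFintype_apply]

theorem volume_cantorSet : volume cantorSet = 0 := by
  have h1 : volume ((· / 3) '' cantorSet) = ENNReal.ofReal 3⁻¹ * volume cantorSet := by
    simp_rw [div_eq_mul_inv, mul_comm _ (3⁻¹ : ℝ), ← smul_eq_mul, Set.image_smul,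
      Measure.addHaar_smul]
    simp
  have h2 : volume ((fun x => (2 + x) / 3) '' cantorSet) =
      ENNReal.ofReal 3⁻¹ * volume cantorSet := by
    rw [← h1, show (fun x : ℝ => (2 + x) / 3) = (fun x => 2 / 3 + x) ∘ (· / 3) by
      ext x; simp [add_div], Set.image_comp, Set.image_add_left, measure_preimage_add]
  have hle : volume cantorSet ≤
      ENNReal.ofReal 3⁻¹ * volume cantorSet + ENNReal.ofReal 3⁻¹ * volume cantorSet := by
    nth_rewrite 1 [cantorSet_eq_union_halves]
    exact (measure_union_le _ _).trans_eq (by rw [h1, h2])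
  have hfin : volume cantorSet ≠ ∞ := isCompact_cantorSet.measure_ne_top
  refine ((ENNReal.toReal_eq_zero_iff _).1 ?_).resolve_right hfin
  have := ENNReal.toReal_mono (by finiteness) hle
  rw [ENNReal.toReal_add (by finiteness) (by finiteness), ENNReal.toReal_mul,
    ENNReal.toReal_ofReal (by norm_num)] at this
  linarith [ENNReal.toReal_nonneg (a := volume cantorSet)]

/-- The product of two Cantor measures, on the plane `ℂ`. Its dimension is
`log 4 / log 3 > 1`. -/
noncomputable def cantorDustMeasure : Measure ℂ :=
  (cantorMeasure.prod cantorMeasure).map Complex.measurableEquivRealProd.symm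

instance isProbabilityMeasure_cantorDustMeasure : IsProbabilityMeasure cantorDustMeasure :=
  Measure.isProbabilityMeasure_map (MeasurableEquiv.measurable _).aemeasurable

theorem ae_mem_cantorSet_reProdIm :
    ∀ᵐ z ∂cantorDustMeasure, z ∈ cantorSet ×ℂ cantorSet := by
  refine (ae_map_iff (MeasurableEquiv.measurable _).aemeasurable
    (isCompact_cantorSet.reProdIm isCompact_cantorSet).isClosed.measurableSet).2 ?_
  filter_upwards [Measure.quasiMeasurePreserving_fst.ae ae_mem_cantorSet,
    Measure.quasiMeasurePreserving_snd.ae ae_mem_cantorSet] with p h1 h2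
  exact ⟨h1, h2⟩

theorem cantorDustMeasure_ball_le (n : ℕ) (z : ℂ) :
    cantorDustMeasure.real (Metric.ball z (3⁻¹ ^ n)) ≤ 4 * 4⁻¹ ^ n := by
  rcases n with _ | n
  · exact measureReal_le_one.trans (by norm_num)
  have hsub : Complex.measurableEquivRealProd.symm ⁻¹' Metric.ball z (3⁻¹ ^ (n + 1)) ⊆
      Metric.ball z.re (3⁻¹ ^ (n + 1)) ×ˢ Metric.ball z.im (3⁻¹ ^ (n + 1)) := fun p hp => by
    rw [Set.mem_preimage, Metric.mem_ball, dist_eq_norm] at hp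
    exact ⟨(Complex.abs_re_le_norm _).trans_lt hp, (Complex.abs_im_le_norm _).trans_lt hp⟩
  have h : cantorDustMeasure (Metric.ball z (3⁻¹ ^ (n + 1))) ≤ 2⁻¹ ^ n * 2⁻¹ ^ n := by
    rw [cantorDustMeasure, MeasurableEquiv.map_apply]
    refine (measure_mono hsub).trans ?_
    rw [Measure.prod_prod]
    exact mul_le_mul' (cantorMeasure_ball_le n _) (cantorMeasure_ball_le n _)
  refine (ENNReal.toReal_mono (by finiteness) h).trans_eq ?_
  simp only [ENNReal.toReal_mul, ENNReal.toReal_pow, ENNReal.toReal_inv, ENNReal.toReal_ofNat]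
  rw [← mul_pow, pow_succ]
  norm_num
  ring

theorem volume_cantorSet_reProdIm : volume (cantorSet ×ℂ cantorSet) = 0 := by
  have : cantorSet ×ℂ cantorSet =
      Complex.measurableEquivRealProd ⁻¹' (cantorSet ×ˢ cantorSet) := rfl
  rw [this, Complex.volume_preserving_equiv_real_prod.measure_preimage_equiv,
    Measure.volume_eq_prod, Measure.prod_prod, volume_cantorSet, zero_mul]

theorem dense_compl_cantorSet : Dense cantorSetᶜ := by
  rw [← interior_eq_empty_iff_dense_compl]
  exact Measure.interior_eq_empty_of_null volume_cantorSet

/-! ### The capacities of the Cantor dust -/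

theorem theorem3p19 :
    (0 < contAnalyticCapacity 0 (cantorSet ×ℂ cantorSet) ∧
      contAnalyticCapacity 1 (cantorSet ×ℂ cantorSet) = 0) ∧
    (∀ L : Set ℂ, IsCompact L → volume L = 0 →
      Dense {y : ℝ | {z : ℂ | z ∈ L ∧ z.im = y}.Finite} →
      Dense {x : ℝ | {z : ℂ | z ∈ L ∧ z.re = x}.Finite} →
      contAnalyticCapacity 1 L = 0) := by
  have hcomp := isCompact_cantorSet.reProdIm isCompact_cantorSet
  refine ⟨⟨?_, ?_⟩, fun L hL h0 hy hx => contAnalyticCapacity_one_eq_zero hL h0 hy hx⟩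
  · exact contAnalyticCapacity_zero_pos cantorDustMeasure (by norm_num) (by norm_num)
      (by norm_num) (by norm_num) cantorDustMeasure_ball_le hcomp ae_mem_cantorSet_reProdIm
  · -- A line at a coordinate outside the Cantor set misses the product.
    refine contAnalyticCapacity_one_eq_zero hcomp volume_cantorSet_reProdIm
      (dense_compl_cantorSet.mono fun y hy => ?_) (dense_compl_cantorSet.mono fun x hx => ?_)
    · refine Set.finite_empty.subset ?_
      rintro z ⟨hz, rfl⟩
      exact hy hz.2
    · refine Set.finite_empty.subset ?_
      rintro z ⟨hz, rfl⟩
      exact hx hz.1
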